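/- Let $n$ be a positive even integer, and let $A_n$ be the path on the vertices $1,\dots,n$, with edges $\{i,i+1\}$ for $1\le i<n$. Let $Q=A+D$ be its signless Laplacian matrix, where $A$ is the adjacency matrix and $D$ the diagonal matrix of vertex degrees, and let $$W_Q(A_n)=[\,e,\ Qe,\ \dots,\ Q^{n-1}e\,]\in\mathbb Z^{n\times n}$$ be its $Q$-walk matrix, where $e$ is the all-ones vector. For an integral $n\times n$ matrix $M$ of rank $\rho$, let $D(0)=1$, let $D(k)\ge 0$ be the greatest common divisor of all minors of order $k$ of $M$ for $1\le k\le n$, and let $d_k=D(k)/D(k-1)$ for $1\le k\le \rho$; the Smith normal form of $M$ is $\mathrm{diag}(d_1,\dots,d_\rho,0,\dots,0)$. Then $W_Q(A_n)$ has rank $r=\lceil n/2\rceil$, and its Smith normal form is the $n\times n$ matrix $$\mathrm{diag}(\underbrace{1,2,2,\dots,2}_{r},0,\dots,0).$$ -/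

import Mathlib

/-- The walk matrix `W(M) = [e, M e, …, M^(n-1) e]`, where `e` is the all-ones vector. -/
def walkMatrix {n : ℕ} (M : Matrix (Fin n) (Fin n) ℤ) : Matrix (Fin n) (Fin n) ℤ :=
  Matrix.of fun i j => Matrix.mulVec (M ^ (j : ℕ)) (fun _ => 1) i

/-- The signless Laplacian matrix `Q(G) = A(G) + D(G)`. -/
def signlessLaplacian {V : Type*} [Fintype V] [DecidableEq V] (G : SimpleGraph V)
    [DecidableRel G.Adj] : Matrix V V ℤ :=
  G.adjMatrix ℤ + G.degMatrix ℤ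

/-- The `Q`-walk matrix `W_Q(G)` of a graph `G` with vertices numbered by `Fin n`. -/
def qWalkMatrix {n : ℕ} (G : SimpleGraph (Fin n)) [DecidableRel G.Adj] :
    Matrix (Fin n) (Fin n) ℤ :=
  walkMatrix (signlessLaplacian G)

/-- The rank of an integral matrix, that is, its rank over the field of rational numbers. -/
noncomputable def intRank {n : ℕ} (M : Matrix (Fin n) (Fin n) ℤ) : ℕ :=
  (M.map (Int.cast : ℤ → ℚ)).rank

open Classical in
/-- The `k`-th determinant divisor `D(k)`: the nonnegative greatest common divisor of all minors of
order `k`. A minor is given by increasing choices of `k` rows and `k` columns; for `k = 0` the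
only minor is the empty determinant, so `D(0) = 1`. -/
noncomputable def determinantDivisor {n : ℕ} (M : Matrix (Fin n) (Fin n) ℤ) (k : ℕ) : ℤ :=
  (Finset.univ.filter fun p : (Fin k → Fin n) × (Fin k → Fin n) =>
    StrictMono p.1 ∧ StrictMono p.2).gcd fun p => (M.submatrix p.1 p.2).det

/-- The invariant factor `d_k = D(k) / D(k-1)`, meant for `1 ≤ k ≤ rank M`, where the division
is exact and the divisor is not zero. -/
noncomputable def invariantFactor {n : ℕ} (M : Matrix (Fin n) (Fin n) ℤ) (k : ℕ) : ℤ :=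
  determinantDivisor M k / determinantDivisor M (k - 1)

/-- The Smith normal form `diag(d_1, …, d_r, 0, …, 0)`, where `r` is the rank of `M`. The index
`i : Fin n` counts from zero, so that position `i` holds the `(i + 1)`-st invariant factor. -/
noncomputable def smithNormalForm {n : ℕ} (M : Matrix (Fin n) (Fin n) ℤ) :
    Matrix (Fin n) (Fin n) ℤ :=
  Matrix.diagonal fun i =>
    if (i : ℕ) < intRank M then invariantFactor M ((i : ℕ) + 1) else 0

/-! Each entry of `Qe` is a sum of terms `1 + 1`, so every column of the walk matrix but the first
is even, and `2 ^ k` divides all minors of order `k + 1`. For `k + 1 ≤ n / 2` the leading minor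
equals `2 ^ k`: subtracting from each row its predecessor gives a triangular matrix with diagonal
`1, 2, …, 2` (`pow_mulVec_one_succ_sub`). Hence `D(k + 1) = 2 ^ k`. Reversing the path fixes `e` and
commutes with `Q`, so mirror rows agree and the rank is at most `n / 2`; the leading minor gives
equality. -/

section

open Matrix SimpleGraph

/-- The signless Laplacian sums `v i + v j` over the neighbours `j` of `i`. -/
theorem signlessLaplacian_mulVec_apply {V : Type*} [Fintype V] [DecidableEq V]
    (G : SimpleGraph V) [DecidableRel G.Adj] (v : V → ℤ) (i : V) :
    (signlessLaplacian G *ᵥ v) i = ∑ j ∈ G.neighborFinset i, (v i + v j) := by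
  rw [signlessLaplacian, Matrix.add_mulVec, Pi.add_apply, degMatrix_mulVec_apply,
    adjMatrix_mulVec_apply, Finset.sum_add_distrib, Finset.sum_const, card_neighborFinset_eq_degree,
    nsmul_eq_mul, add_comm]

theorem signlessLaplacian_mulVec_comp_iso {V : Type*} [Fintype V] [DecidableEq V]
    (G : SimpleGraph V) [DecidableRel G.Adj] (φ : G ≃g G) (v : V → ℤ) :
    (signlessLaplacian G *ᵥ (v ∘ φ)) = (signlessLaplacian G *ᵥ v) ∘ φ := by
  ext i
  simp only [Function.comp_apply, signlessLaplacian_mulVec_apply]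
  exact Finset.sum_equiv φ.toEquiv (by simp [φ.map_adj_iff]) (by simp)

theorem even_signlessLaplacian_mulVec_one {V : Type*} [Fintype V] [DecidableEq V]
    (G : SimpleGraph V) [DecidableRel G.Adj] (i : V) :
    (2 : ℤ) ∣ (signlessLaplacian G *ᵥ fun _ => 1) i := by
  rw [signlessLaplacian_mulVec_apply]
  exact Finset.dvd_sum fun _ _ => by norm_num

theorem dvd_mulVec_apply {V R : Type*} [Fintype V] [CommRing R] (M : Matrix V V R) {v : V → R}
    {a : R} (h : ∀ i, a ∣ v i) (i : V) : a ∣ (M *ᵥ v) i :=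
  Finset.dvd_sum fun j _ => (h j).mul_left _

/-- All columns of a `Q`-walk matrix but the first are even. -/
theorem two_dvd_qWalkMatrix {n : ℕ} (G : SimpleGraph (Fin n)) [DecidableRel G.Adj]
    (i j : Fin n) (hj : 0 < (j : ℕ)) : (2 : ℤ) ∣ qWalkMatrix G i j := by
  obtain ⟨m, hm⟩ := Nat.exists_eq_succ_of_ne_zero hj.ne'
  simp only [qWalkMatrix, walkMatrix, Matrix.of_apply, hm, pow_succ, ← Matrix.mulVec_mulVec]
  exact dvd_mulVec_apply _ (even_signlessLaplacian_mulVec_one G) i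

/-- The reversal of a path. -/
def pathGraphRev (n : ℕ) : pathGraph n ≃g pathGraph n where
  toEquiv := Fin.revPerm
  map_rel_iff' := by
    intro a b
    simp only [pathGraph_adj, Fin.revPerm_apply, Fin.val_rev]
    omega

section Path

variable {n : ℕ} [DecidableRel (pathGraph n).Adj]

theorem pow_signlessLaplacian_mulVec_one_rev (m : ℕ) (i : Fin n) :
    (signlessLaplacian (pathGraph n) ^ m *ᵥ fun _ => 1) i.rev =
      (signlessLaplacian (pathGraph n) ^ m *ᵥ fun _ => 1) i := by
  suffices h : (signlessLaplacian (pathGraph n) ^ m *ᵥ fun _ => 1) ∘ pathGraphRev n =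
      signlessLaplacian (pathGraph n) ^ m *ᵥ fun _ => 1 from congrFun h i
  induction m with
  | zero => ext; simp
  | succ m ih => rw [pow_succ', ← mulVec_mulVec, ← signlessLaplacian_mulVec_comp_iso, ih]

theorem pathGraph_mulVec_zero (v : Fin n → ℤ) (h : 1 < n) :
    (signlessLaplacian (pathGraph n) *ᵥ v) ⟨0, by omega⟩ = v ⟨0, by omega⟩ + v ⟨1, h⟩ := by
  have hN : (pathGraph n).neighborFinset ⟨0, by omega⟩ = {⟨1, h⟩} := by
    ext j
    simp only [mem_neighborFinset, pathGraph_adj, Finset.mem_singleton, Fin.ext_iff]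
    omega
  rw [signlessLaplacian_mulVec_apply, hN, Finset.sum_singleton]

theorem pathGraph_mulVec_succ (v : Fin n → ℤ) (i : ℕ) (h : i + 2 < n) :
    (signlessLaplacian (pathGraph n) *ᵥ v) ⟨i + 1, by omega⟩ =
      v ⟨i, by omega⟩ + 2 * v ⟨i + 1, by omega⟩ + v ⟨i + 2, h⟩ := by
  have hN : (pathGraph n).neighborFinset ⟨i + 1, by omega⟩ =
      {⟨i, by omega⟩, ⟨i + 2, h⟩} := by
    ext j
    simp only [mem_neighborFinset, pathGraph_adj, Finset.mem_insert, Finset.mem_singleton,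
      Fin.ext_iff]
    omega
  rw [signlessLaplacian_mulVec_apply, hN, Finset.sum_pair (by simp [Fin.ext_iff])]
  ring

/-- The differences of consecutive rows of the `Q`-walk matrix of a path form a triangular array
near its top left corner. -/
theorem pow_mulVec_one_succ_sub (m : ℕ) : ∀ (i : ℕ) (h : i + 1 + m < n), m ≤ i + 1 →
    (signlessLaplacian (pathGraph n) ^ m *ᵥ fun _ => 1) ⟨i + 1, by omega⟩ -
      (signlessLaplacian (pathGraph n) ^ m *ᵥ fun _ => 1) ⟨i, by omega⟩ =
      if m = i + 1 then 2 else 0 := by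
  induction m with
  | zero => intro i h _; simp
  | succ m ih =>
    intro i h hm
    rw [pow_succ', ← mulVec_mulVec]
    have h1 := ih i (by omega) (by omega)
    have h2 := ih (i + 1) (by omega) (by omega)
    cases i with
    | zero =>
      obtain rfl : m = 0 := by omega
      simp [pathGraph_mulVec_zero _ (show 1 < n by omega),
        pathGraph_mulVec_succ _ 0 (show 0 + 2 < n by omega)]
    | succ i =>
      have h0 := ih i (by omega) (by omega)
      -- With `d i = v (i + 1) - v i`, applying `Q` turns `d (i + 1)` into `d i + 2 * d (i + 1) + d
      -- (i + 2)`; the last two terms vanish by induction.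
      rw [pathGraph_mulVec_succ _ (i + 1) (by omega), pathGraph_mulVec_succ _ i (by omega)]
      rw [if_neg (by omega)] at h1 h2
      have hif : (if m + 1 = i + 1 + 1 then (2 : ℤ) else 0) = if m = i + 1 then 2 else 0 := by
        simp
      rw [hif]
      linarith

/-- The leading principal minors of the `Q`-walk matrix of a path, up to half its size. -/
theorem det_leading_qWalkMatrix_pathGraph (k : ℕ) (hk : 2 * (k + 1) ≤ n) :
    ((qWalkMatrix (pathGraph n)).submatrix (Fin.castLE (show k + 1 ≤ n by omega))
      (Fin.castLE (show k + 1 ≤ n by omega))).det = 2 ^ k := by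
  set A := (qWalkMatrix (pathGraph n)).submatrix (Fin.castLE (show k + 1 ≤ n by omega))
      (Fin.castLE (show k + 1 ≤ n by omega)) with hA
  let B : Matrix (Fin (k + 1)) (Fin (k + 1)) ℤ :=
    Matrix.of fun i j => Fin.cases (A 0 j) (fun i => A i.succ j - A i.castSucc j) i
  have hB : ∀ (i : Fin k) (j : Fin (k + 1)), (j : ℕ) ≤ i + 1 →
      B i.succ j = if (j : ℕ) = i + 1 then 2 else 0 := by
    intro i j hij
    exact pow_mulVec_one_succ_sub (n := n) (j : ℕ) (i : ℕ) (by omega) hij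
  have hdet : A.det = B.det :=
    det_eq_of_forall_row_eq_smul_add_pred (fun _ => 1) (fun _ => rfl) fun i j => by simp [B]
  have hB0 : B 0 0 = 1 := by simp [B, A, qWalkMatrix, walkMatrix]
  have htri : B.BlockTriangular id := by
    intro i j hij
    have hij' : j < i := hij
    obtain ⟨i, rfl⟩ := Fin.exists_succ_eq_of_ne_zero (Fin.ne_zero_of_lt hij')
    rw [Fin.lt_def, Fin.val_succ] at hij'
    rw [hB i j (by omega), if_neg (by omega)]
  rw [hdet, det_of_isUpperTriangular htri, Fin.prod_univ_succ, hB0, one_mul,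
    Finset.prod_congr rfl fun i _ => (hB i i.succ (by simp)).trans (if_pos (by simp))]
  simp

end Path

/-- If all columns of `M` but the first are divisible by `a`, then `a ^ k` divides the minors
of order `k + 1`. -/
theorem pow_dvd_det_submatrix {n k : ℕ} {M : Matrix (Fin n) (Fin n) ℤ} {a : ℤ}
    (hM : ∀ i j : Fin n, 0 < (j : ℕ) → a ∣ M i j) (f g : Fin (k + 1) → Fin n) (hg : StrictMono g) :
    a ^ k ∣ (M.submatrix f g).det := by
  have h : ∀ i j, ∃ c, M (f i) (g j) = (if j = 0 then 1 else a) * c := by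
    intro i j
    split_ifs with hj
    · exact ⟨_, (one_mul _).symm⟩
    -- Strict monotonicity keeps `g j` off column `0`, so at most one chosen column lacks the factor
    -- `a`.
    · have : g 0 < g j := hg (Fin.pos_of_ne_zero hj)
      exact hM _ _ (by rw [Fin.lt_def] at this; omega)
  choose N hN using h
  have hdet : (M.submatrix f g).det =
      (∏ j : Fin (k + 1), if j = 0 then 1 else a) * (Matrix.of N).det := by
    rw [← det_mul_row]
    congr 1
    ext i j
    exact hN i j
  rw [hdet, Fin.prod_univ_succ]
  simp

theorem determinantDivisor_zero {n : ℕ} (M : Matrix (Fin n) (Fin n) ℤ) :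
    determinantDivisor M 0 = 1 := by
  refine dvd_antisymm_of_normalize_eq Finset.normalize_gcd normalize_one ?_ (one_dvd _)
  refine (Finset.gcd_dvd (b := (Fin.elim0, Fin.elim0)) ?_).trans (by simp)
  simp [StrictMono]

theorem determinantDivisor_qWalkMatrix_pathGraph {n k : ℕ} [DecidableRel (pathGraph n).Adj]
    (hk : 2 * (k + 1) ≤ n) :
    determinantDivisor (qWalkMatrix (pathGraph n)) (k + 1) = 2 ^ k := by
  refine dvd_antisymm_of_normalize_eq Finset.normalize_gcd
    (Int.normalize_of_nonneg (by positivity)) ?_ (Finset.dvd_gcd fun p hp => ?_)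
  · rw [← det_leading_qWalkMatrix_pathGraph k hk]
    refine Finset.gcd_dvd (b := (Fin.castLE (show k + 1 ≤ n by omega),
      Fin.castLE (show k + 1 ≤ n by omega))) ?_
    simp [Fin.strictMono_castLE]
  · exact pow_dvd_det_submatrix (two_dvd_qWalkMatrix _) _ _ (Finset.mem_filter.1 hp).2.2

theorem intRank_qWalkMatrix_pathGraph {n r : ℕ} [DecidableRel (pathGraph n).Adj] (hr : 0 < r)
    (hn : n = 2 * r) : intRank (qWalkMatrix (pathGraph n)) = r := by
  set W := qWalkMatrix (pathGraph n) with hW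
  have hrn : r ≤ n := by omega
  apply le_antisymm
  -- `f` folds the second half of the path onto the first, so `W` only repeats its first `r` rows.
  · let f : Fin n → Fin r := fun i =>
      if h : (i : ℕ) < r then ⟨i, h⟩ else ⟨i.rev, by rw [Fin.val_rev]; omega⟩
    have hf : W = (W.submatrix (Fin.castLE hrn) id).submatrix f id := by
      ext i j
      by_cases h : (i : ℕ) < r
      · simp [f, h]
      · have hfi : Fin.castLE hrn (f i) = i.rev := by simp [f, h, Fin.ext_iff]
        rw [submatrix_apply, submatrix_apply, hfi]
        exact (pow_signlessLaplacian_mulVec_one_rev (j : ℕ) i).symm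
    calc (W.map (Int.cast : ℤ → ℚ)).rank
        = (((W.submatrix (Fin.castLE hrn) id).map (Int.cast : ℤ → ℚ)).submatrix f id).rank := by
          conv_lhs => rw [hf]
          rfl
      _ ≤ ((W.submatrix (Fin.castLE hrn) id).map (Int.cast : ℤ → ℚ)).rank := rank_submatrix_le ..
      _ ≤ r := rank_le_height _
  · obtain ⟨k, rfl⟩ := Nat.exists_eq_succ_of_ne_zero hr.ne'
    have hdet := det_leading_qWalkMatrix_pathGraph (n := n) k (by omega)
    set A := W.submatrix (Fin.castLE hrn) (Fin.castLE hrn) with hA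
    have hu : IsUnit (A.map (Int.cast : ℤ → ℚ)) := by
      rw [isUnit_iff_isUnit_det, isUnit_iff_ne_zero, ← Int.cast_det]
      rw [show A.det = 2 ^ k from hdet]
      positivity
    calc k.succ = (A.map (Int.cast : ℤ → ℚ)).rank := by rw [rank_of_isUnit _ hu, Fintype.card_fin]
      _ = ((W.map (Int.cast : ℤ → ℚ)).submatrix (Fin.castLE hrn) (Fin.castLE hrn)).rank := rfl
      _ ≤ _ := rank_submatrix_le ..

theorem invariantFactor_qWalkMatrix_pathGraph {n i : ℕ} [DecidableRel (pathGraph n).Adj]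
    (hi : 2 * (i + 1) ≤ n) :
    invariantFactor (qWalkMatrix (pathGraph n)) (i + 1) = if i = 0 then 1 else 2 := by
  rw [invariantFactor, determinantDivisor_qWalkMatrix_pathGraph hi, Nat.add_sub_cancel]
  cases i with
  | zero => simp [determinantDivisor_zero]
  | succ i =>
    rw [determinantDivisor_qWalkMatrix_pathGraph (by omega), if_neg (by omega), pow_succ,
      Int.mul_ediv_cancel_left _ (by positivity)]

end

/-- For `n` even, the `Q`-walk matrix of the path `A_n` has rank `r = ⌈n/2⌉`, and its Smith normal
form is `diag(1, 2, …, 2, 0, …, 0)` with `r` nonzero entries. -/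
theorem corollary3p6 (n : ℕ) (hpos : 0 < n) (hn : Even n)
    [DecidableRel (SimpleGraph.pathGraph n).Adj] :
    intRank (qWalkMatrix (SimpleGraph.pathGraph n)) = ⌈(n : ℚ) / 2⌉₊ ∧
    smithNormalForm (qWalkMatrix (SimpleGraph.pathGraph n)) =
      Matrix.diagonal fun i : Fin n =>
        if (i : ℕ) = 0 then 1 else if (i : ℕ) < ⌈(n : ℚ) / 2⌉₊ then 2 else 0 := by
  obtain ⟨r, hr⟩ := hn.two_dvd
  have hceil : ⌈(n : ℚ) / 2⌉₊ = r := by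
    rw [hr, Nat.cast_mul, Nat.cast_ofNat, mul_div_cancel_left₀ _ (by norm_num), Nat.ceil_natCast]
  have hrank := intRank_qWalkMatrix_pathGraph (n := n) (r := r) (by omega) hr
  rw [hceil]
  refine ⟨hrank, ?_⟩
  rw [smithNormalForm, hrank]
  congr 1
  funext i
  by_cases hi : (i : ℕ) < r
  · rw [if_pos hi, if_pos hi, invariantFactor_qWalkMatrix_pathGraph (by omega)]
  -- Here `i ≥ r > 0`, so position `0` is excluded.
  · rw [if_neg hi, if_neg hi, if_neg (by omega)]
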